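/- \textbf{Setting.} In a $K$-user MIMO interference network, transmitter $i$ has $N_i$ antennas, receiver $j$ has $M_j$ antennas, and user $i$ sends $d_i$ data streams. The channel matrices $\mathbf H_{ji}\in\mathbb C^{M_j\times N_i}$ (from transmitter $i$ to receiver $j$) have i.i.d. complex Gaussian entries with zero mean and unit variance. A \emph{feedback profile} $\mathcal L$ consists of integers $0\le M_j^s\le M_j$, $0\le N_i^s\le N_i$ and, for each $j$, a partition of $\{1,\dots,K\}\setminus\{j\}$ into sets $\Omega_j^{I},\Omega_j^{II},\Omega_j^{III},\Omega_j^{IV}$. Let $\mathbf H_{ji}^s$ be the upper left $M_j^s\times N_i^s$ block of $\mathbf H_{ji}$, let the columns of $\mathbf S_j^r$ be an orthonormal basis of $\{\mathbf u:\mathbf u^\dagger\mathbf H^s_{ji}=\mathbf 0\ \forall i\in\Omega_j^{II}\}$, and let $M_j^e=M_j^s-\sum_{i\in\Omega_j^{II}}N_i^s$. Receiver $j$ feeds back the null spaces of $(\mathbf S_j^r)^\dagger\mathbf H^s_{jp}$, $p\in\Omega_j^{III}$, and the row space $\mathrm{span}\big([\cdots(\mathbf S_j^r)^\dagger\mathbf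 H^s_{jq}\cdots]_{q\in\Omega_j^{IV}}^T\big)$. The \emph{feedback dimension} is the sum of the dimensions $A(B-A)$ of the Grassmannians $\mathbb G(A,B)$ of $A$-dimensional subspaces of $\mathbb C^B$ that almost surely contain these subspaces; for a profile it is given by $$D(\mathcal L)=\sum_{j}M_j^e\Big(\sum_{i\in\Omega_j^{IV}}N_i^s-M_j^e\Big)^{+}+\sum_{j}\sum_{i\in\Omega_j^{III}}M_j^e\,(N_i^s-M_j^e).$$ The profile \emph{achieves interference alignment (IA)} if there are precoders $\mathbf V_i\in\mathbb C^{N_i\times d_i}$ that are functions of the fed back subspaces of all receivers only, and decorrelators $\mathbf U_j\in\mathbb C^{M_j\times d_j}$ that are functions of $\{\mathbf H_{ji}\mathbf V_i:\forall i\}$ only, such that almost surely $\mathrm{rank}(\mathbf U_j^\dagger\mathbf H_{jj}\mathbf V_j)=d_j$ for all $j$ and $\mathbf U_j^\dagger\mathbf H_{ji}\mathbf V_i=\mathbf 0$ for all $i\ne j$. \textbf{Theorem 3.} Let $K\ge 2$, $d_i=d$, $M_i=M$, $N_i=N=\tfrac12KM$ for all $i$, where $2\mid M$, $M\le 2K+1$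 and $d\mid M$. (a) If $d\le M/K$, then the feedback profile with $N_i^s=d$, $M_i^s=M$ for all $i$, and $\Omega_j^{I}=\{1,\dots,K\}\setminus\{j\}$, $\Omega_j^{II}=\Omega_j^{III}=\Omega_j^{IV}=\emptyset$ for all $j$, achieves IA, and its feedback dimension is $0$. (b) If $d=M/(K-\kappa)$ with an integer $1\le\kappa\le K-2$, then the feedback profile with $N_i^s=Kd$, $M_i^s=M$ for $i\in\{1,\dots,\kappa+1\}$; $N_i^s=d$, $M_i^s=M-d$ for $i\in\{\kappa+2,\dots,K\}$; and $\Omega_j^{I}=\Omega_j^{IV}=\emptyset$, $\Omega_j^{II}=\{\kappa+2,\dots,K\}\setminus\{j\}$, $\Omega_j^{III}=\{1,\dots,\kappa+1\}\setminus\{j\}$ for all $j$, achieves IA, and its feedback dimension is $\big((K+1)d^2-Md\big)(K-1)^2$. -/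

import Mathlib

open MeasureTheory ProbabilityTheory
open scoped Matrix

namespace InterferenceNetwork

/-- The channel matrices of a `K`-user MIMO interference network: `H j i` is the `M j × N i` matrix
from transmitter `i` (with `N i` antennas) to receiver `j` (with `M j` antennas). -/
abbrev Channel (K : ℕ) (M N : Fin K → ℕ) : Type :=
  ∀ j i : Fin K, Matrix (Fin (M j)) (Fin (N i)) ℂ

/-- The random channel `H` has independent, identically distributed, complex Gaussian entries with
zero mean and unit variance.  Circular symmetry of the entries is not required. -/
structure IsGaussianChannel {K : ℕ} {M N : Fin K → ℕ} {Ω : Type*} [MeasurableSpace Ω]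
    (P : Measure Ω) (H : Ω → Channel K M N) : Prop where
  gaussian : ∀ (j i : Fin K) (a : Fin (M j)) (b : Fin (N i)),
    HasGaussianLaw (fun ω => H ω j i a b) P
  mean_zero : ∀ (j i : Fin K) (a : Fin (M j)) (b : Fin (N i)), ∫ ω, H ω j i a b ∂P = 0
  variance_one : ∀ (j i : Fin K) (a : Fin (M j)) (b : Fin (N i)), ∫ ω, ‖H ω j i a b‖ ^ 2 ∂P = 1
  identDistrib : ∀ (j i : Fin K) (a : Fin (M j)) (b : Fin (N i))
    (j' i' : Fin K) (a' : Fin (M j')) (b' : Fin (N i')),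
    IdentDistrib (fun ω => H ω j i a b) (fun ω => H ω j' i' a' b') P P
  indep : iIndepFun
    (fun (e : Σ p : Fin K × Fin K, Fin (M p.1) × Fin (N p.2)) (ω : Ω) =>
      H ω e.1.1 e.1.2 e.2.1 e.2.2) P

/-- The four feedback strategies. -/
inductive Strategy : Type
  | I
  | II
  | III
  | IV

/-- A feedback profile: the numbers `Ms j ≤ M j` and `Ns i ≤ N i` of antennas that are used at
receiver `j` and transmitter `i`, and, for every receiver `j`, a partition
`link I j, link II j, link III j, link IV j` of the set of its cross links. -/
structure FeedbackProfile (K : ℕ) (M N : Fin K → ℕ) where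
  Ms : Fin K → ℕ
  Ns : Fin K → ℕ
  link : Strategy → Fin K → Finset (Fin K)
  Ms_le : ∀ j, Ms j ≤ M j
  Ns_le : ∀ i, Ns i ≤ N i
  cover : ∀ j i, i ≠ j ↔ ∃ m, i ∈ link m j
  disjoint : ∀ j m n, m ≠ n → Disjoint (link m j) (link n j)

namespace FeedbackProfile

variable {K : ℕ} {M N : Fin K → ℕ} (L : FeedbackProfile K M N)

/-- `M_j^e = M_j^s - ∑_{i ∈ Ω_j^II} N_i^s`. -/
def Me (j : Fin K) : ℤ := (L.Ms j : ℤ) - ∑ i ∈ L.link .II j, (L.Ns i : ℤ)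

/-- The feedback dimension of a profile,
`∑_j M_j^e (∑_{i ∈ Ω_j^IV} N_i^s - M_j^e)^+ + ∑_j ∑_{i ∈ Ω_j^III} M_j^e (N_i^s - M_j^e)`. -/
def feedbackDimension : ℤ :=
  ∑ j, L.Me j * max ((∑ i ∈ L.link .IV j, (L.Ns i : ℤ)) - L.Me j) 0
    + ∑ j, ∑ i ∈ L.link .III j, L.Me j * ((L.Ns i : ℤ) - L.Me j)

/-- The submatrix `H_{ji}^s` of `H_{ji}`: the first `M_j^s` rows and the first `N_i^s` columns. -/
def sub (j : Fin K) (G : ∀ i, Matrix (Fin (M j)) (Fin (N i)) ℂ) (i : Fin K) :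
    Matrix (Fin (L.Ms j)) (Fin (L.Ns i)) ℂ :=
  (G i).submatrix (Fin.castLE (L.Ms_le j)) (Fin.castLE (L.Ns_le i))

/-- `span (S_j^r)`: the vectors `u` with `u† H_{ji}^s = 0`, i.e. `(H_{ji}^s)† u = 0`, for all
`i ∈ Ω_j^II`. -/
def leftNull (j : Fin K) (G : ∀ i, Matrix (Fin (M j)) (Fin (N i)) ℂ) :
    Submodule ℂ (Fin (L.Ms j) → ℂ) :=
  ⨅ i ∈ L.link .II j, LinearMap.ker ((L.sub j G i)ᴴ).mulVecLin

/-- The null space of `(S_j^r)† H_{jp}^s`: the vectors `x` with `s† H_{jp}^s x = 0` for all `s` in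
the column span of `S_j^r`.  It does not depend on the basis chosen as columns of `S_j^r`, see
`nullFeedback_eq`. -/
def nullFeedback (j : Fin K) (G : ∀ i, Matrix (Fin (M j)) (Fin (N i)) ℂ) (p : Fin K) :
    Submodule ℂ (Fin (L.Ns p) → ℂ) :=
  { carrier := {x | ∀ s ∈ L.leftNull j G, star s ⬝ᵥ (L.sub j G p *ᵥ x) = 0}
    add_mem' := fun hx hy s hs => by
      rw [Matrix.mulVec_add, dotProduct_add, hx s hs, hy s hs, add_zero]
    zero_mem' := fun s _ => by rw [Matrix.mulVec_zero, dotProduct_zero]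
    smul_mem' := fun c x hx s hs => by
      rw [Matrix.mulVec_smul, dotProduct_smul, hx s hs, smul_zero] }

/-- The index set of the columns of the concatenation of the `H_{jq}^s`, `q ∈ Ω_j^IV`. -/
abbrev ConcatIndex (j : Fin K) : Type := Σ q : {q // q ∈ L.link .IV j}, Fin (L.Ns q.1)

/-- The concatenated matrix `[ ⋯ H_{jq}^s ⋯ ]`, `q ∈ Ω_j^IV`. -/
def concat (j : Fin K) (G : ∀ i, Matrix (Fin (M j)) (Fin (N i)) ℂ) :
    Matrix (Fin (L.Ms j)) (L.ConcatIndex j) ℂ :=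
  Matrix.of fun a c => L.sub j G c.1.1 a c.2

/-- The row space `span [ ⋯ (S_j^r)† H_{jq}^s ⋯ ]^T`, `q ∈ Ω_j^IV`; again independent of the basis
chosen as columns of `S_j^r`, see `rowFeedback_eq`. -/
def rowFeedback (j : Fin K) (G : ∀ i, Matrix (Fin (M j)) (Fin (N i)) ℂ) :
    Submodule ℂ (L.ConcatIndex j → ℂ) :=
  Submodule.span ℂ ((fun s => star s ᵥ* L.concat j G) '' (L.leftNull j G : Set _))

/-- The type of the tuple of subspaces that is fed back by receiver `j`. -/
abbrev Feedback (j : Fin K) : Type :=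
  (∀ p : {p // p ∈ L.link .III j}, Submodule ℂ (Fin (L.Ns p.1) → ℂ)) ×
    Submodule ℂ (L.ConcatIndex j → ℂ)

/-- The feedback function `F_j` of the profile.  It only uses the cross links of receiver `j`,
see `feedback_congr`. -/
def feedback (j : Fin K) (G : ∀ i, Matrix (Fin (M j)) (Fin (N i)) ℂ) : L.Feedback j :=
  (fun p => L.nullFeedback j G p.1, L.rowFeedback j G)

theorem nullFeedback_eq (j : Fin K) (G : ∀ i, Matrix (Fin (M j)) (Fin (N i)) ℂ) (p : Fin K)
    {r : ℕ} (S : Matrix (Fin (L.Ms j)) (Fin r) ℂ)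
    (hS : LinearMap.range S.mulVecLin = L.leftNull j G) :
    L.nullFeedback j G p = LinearMap.ker (Sᴴ * L.sub j G p).mulVecLin := by
  ext x
  rw [LinearMap.mem_ker, Matrix.mulVecLin_apply, ← Matrix.mulVec_mulVec]
  constructor
  · intro hx
    funext k
    have h := hx (S *ᵥ Pi.single k 1) (by rw [← hS]; exact ⟨Pi.single k 1, rfl⟩)
    rw [Matrix.star_mulVec, ← Matrix.dotProduct_mulVec] at h
    simpa using h
  · intro hx s hs
    rw [← hS] at hs
    obtain ⟨y, rfl⟩ := hs
    rw [Matrix.mulVecLin_apply, Matrix.star_mulVec, ← Matrix.dotProduct_mulVec, hx,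
      dotProduct_zero]

theorem rowFeedback_eq (j : Fin K) (G : ∀ i, Matrix (Fin (M j)) (Fin (N i)) ℂ)
    {r : ℕ} (S : Matrix (Fin (L.Ms j)) (Fin r) ℂ)
    (hS : LinearMap.range S.mulVecLin = L.leftNull j G) :
    L.rowFeedback j G = LinearMap.range ((Sᴴ * L.concat j G)ᵀ).mulVecLin := by
  have h : ((fun s => star s ᵥ* L.concat j G) '' (L.leftNull j G : Set _)) =
      (LinearMap.range ((Sᴴ * L.concat j G)ᵀ).mulVecLin : Set _) := by
    rw [← hS]
    ext w
    constructor
    · rintro ⟨s, ⟨y, rfl⟩, rfl⟩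
      refine ⟨star y, ?_⟩
      rw [Matrix.mulVecLin_apply, Matrix.mulVec_transpose]
      simp only [Matrix.mulVecLin_apply]
      rw [Matrix.star_mulVec, Matrix.vecMul_vecMul]
    · rintro ⟨y, rfl⟩
      refine ⟨S *ᵥ star y, ⟨star y, rfl⟩, ?_⟩
      rw [Matrix.mulVecLin_apply, Matrix.mulVec_transpose]
      simp only
      rw [Matrix.star_mulVec, Matrix.vecMul_vecMul, star_star]
  rw [rowFeedback, h, Submodule.span_eq]

theorem feedback_congr (j : Fin K) (G G' : ∀ i, Matrix (Fin (M j)) (Fin (N i)) ℂ)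
    (h : ∀ i, i ≠ j → G i = G' i) : L.feedback j G = L.feedback j G' := by
  have hs : ∀ m, ∀ i ∈ L.link m j, L.sub j G i = L.sub j G' i := fun m i hi => by
    rw [sub, sub, h i ((L.cover j i).2 ⟨m, hi⟩)]
  have hl : L.leftNull j G = L.leftNull j G' :=
    iInf_congr fun i => iInf_congr fun hi => by rw [hs _ i hi]
  have hc : L.concat j G = L.concat j G' := by
    ext a c
    rw [concat, concat, Matrix.of_apply, Matrix.of_apply, hs _ c.1.1 c.1.2]
  refine Prod.ext (funext fun p => ?_) ?_
  · ext x
    change (∀ s ∈ L.leftNull j G, star s ⬝ᵥ (L.sub j G p.1 *ᵥ x) = 0) ↔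
      (∀ s ∈ L.leftNull j G', star s ⬝ᵥ (L.sub j G' p.1 *ᵥ x) = 0)
    rw [hl, hs _ p.1 p.2]
  · change L.rowFeedback j G = L.rowFeedback j G'
    rw [rowFeedback, rowFeedback, hl, hc]

end FeedbackProfile

/-- The dimension `A (B - A)` of the Grassmannian `𝔾(A, B)` that contains the subspace `W` of
`ℂ^B`, where `A` is the dimension of `W`. -/
noncomputable def grassmannDim {ι : Type*} [Fintype ι] (W : Submodule ℂ (ι → ℂ)) : ℤ :=
  (Module.finrank ℂ W : ℤ) * ((Fintype.card ι : ℤ) - (Module.finrank ℂ W : ℤ))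

namespace FeedbackProfile

variable {K : ℕ} {M N : Fin K → ℕ} (L : FeedbackProfile K M N)

/-- The sum of the dimensions of the Grassmannians that contain the subspaces which are fed back
for the channel realization `H`. -/
noncomputable def realizedDimension (H : Channel K M N) : ℤ :=
  ∑ j, ((∑ p, grassmannDim ((L.feedback j (H j)).1 p)) + grassmannDim (L.feedback j (H j)).2)

/-- Interference alignment with `d i` data streams for user `i` is almost surely feasible under the
feedback functions of the profile: there are precoders `V_i` that are functions of the fed back
subspaces only, and decorrelators `U_j` that are functions of `{H_{ji} V_i : i}` only, such that
almost surely `rank (U_j† H_{jj} V_j) = d_j` for all `j`, and `U_j† H_{ji} V_i = 0` for all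
`i ≠ j`. -/
def AchievesIA {Ω : Type*} [MeasurableSpace Ω] (d : Fin K → ℕ)
    (P : Measure Ω) (H : Ω → Channel K M N) : Prop :=
  ∃ (v : (∀ j, L.Feedback j) → ∀ i, Matrix (Fin (N i)) (Fin (d i)) ℂ)
    (u : ∀ j, (∀ i, Matrix (Fin (M j)) (Fin (d i)) ℂ) → Matrix (Fin (M j)) (Fin (d j)) ℂ),
    ∀ᵐ ω ∂P,
      let V : ∀ i, Matrix (Fin (N i)) (Fin (d i)) ℂ := v (fun j => L.feedback j (H ω j))
      let U : ∀ j, Matrix (Fin (M j)) (Fin (d j)) ℂ := fun j => u j (fun i => H ω j i * V i)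
      (∀ j, ((U j)ᴴ * H ω j j * V j).rank = d j) ∧
        ∀ i j, i ≠ j → (U j)ᴴ * H ω j i * V i = 0

end FeedbackProfile

end InterferenceNetwork

/-! Everything reduces to generic full rank. A nonzero polynomial in independent atomless variables
is almost surely nonzero, so a matrix whose entries are zero or distinct channel coefficients almost
surely has independent columns as soon as its columns can be matched to rows along nonzero entries
(`ae_mulVec_injective`).

In (a), the `K * d ≤ M` columns arriving at a receiver are independent, so zero-forcing suffices for
fixed injective precoders.

In (b), let `A` be the set of the first `κ + 1` users. At receiver `k` the strategy-II links span
all but `d` of the used dimensions, so passing to the quotient gives a map `φ k` from `ℂ^(K * d)` to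
a `d`-dimensional space for each transmitter `p ∈ A`. The `K` maps are jointly injective almost
surely (`ae_eq_zero_of_aligned`), hence by dimension jointly bijective. Thus each fed back null
space `ker (φ j)` has dimension `(K - 1) * d`, and those with `j ≠ p` meet in dimension `d`, which
gives the precoder. Joint injectivity makes `φ p` injective on its range, so the desired signal
stays off the interference. A receiver outside `A` sees its own `d` columns independent of its
strategy-II interference. The direct channel enters this argument, but not the precoder. -/

namespace InterferenceNetwork

/-! ### Generic nonvanishing for independent atomless variables -/

/-- A nonzero polynomial does not vanish almost everywhere for a product of atomless measures. -/
theorem ae_eval_ne_zero_fin {n : ℕ} (μ : Fin n → Measure ℂ) [∀ i, IsProbabilityMeasure (μ i)]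
    (hμ : ∀ i z, μ i {z} = 0) (p : MvPolynomial (Fin n) ℂ) (hp : p ≠ 0) :
    ∀ᵐ x ∂Measure.pi μ, MvPolynomial.eval x p ≠ 0 := by
  induction n with
  | zero =>
    refine ae_of_all _ fun x h => hp ?_
    rw [MvPolynomial.eq_C_of_isEmpty p] at h ⊢
    rw [MvPolynomial.eval_C] at h
    rw [h, map_zero]
  | succ n ih =>
    have hq : MvPolynomial.finSuccEquiv ℂ n p ≠ 0 := by simpa using hp
    -- View `p` as a polynomial in the variable 0. By induction a nonzero coefficient survives at
    -- almost every tail `s`; the zero set over such an `s` is then a finite root set, and Fubini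
    -- concludes.
    obtain ⟨k, hk⟩ : ∃ k, (MvPolynomial.finSuccEquiv ℂ n p).coeff k ≠ 0 := by
      by_contra! h
      exact hq (Polynomial.ext (by simpa using h))
    have key : ∀ᵐ z ∂((μ 0).prod (Measure.pi fun j => μ (Fin.succAbove 0 j))),
        MvPolynomial.eval (Fin.cons z.1 z.2 : Fin (n + 1) → ℂ) p ≠ 0 := by
      have hm : MeasurableSet {z : ℂ × (Fin n → ℂ) |
          MvPolynomial.eval (Fin.cons z.1 z.2 : Fin (n + 1) → ℂ) p = 0} := by
        refine (isClosed_eq ?_ continuous_const).measurableSet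
        refine (MvPolynomial.continuous_eval p).comp (continuous_pi fun i => ?_)
        refine Fin.cases ?_ (fun i => ?_) i
        · simpa using continuous_fst
        · simpa [Function.comp_def] using (continuous_apply i).comp continuous_snd
      rw [ae_iff]
      simp only [ne_eq, not_not]
      rw [Measure.prod_apply_symm hm]
      have h0 := ih (fun j => μ (Fin.succAbove 0 j)) (fun j => hμ _) _ hk
      rw [lintegral_congr_ae (g := fun _ => 0), lintegral_zero]
      filter_upwards [h0] with s hs
      have hr : Polynomial.map (MvPolynomial.eval s) (MvPolynomial.finSuccEquiv ℂ n p) ≠ 0 := by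
        intro h
        apply hs
        rw [← Polynomial.coeff_map, h, Polynomial.coeff_zero]
      have hfin : ((fun y => (y, s)) ⁻¹' {z : ℂ × (Fin n → ℂ) |
          MvPolynomial.eval (Fin.cons z.1 z.2 : Fin (n + 1) → ℂ) p = 0}).Finite := by
        refine (Polynomial.finite_setOfPred_isRoot hr).subset fun y hy => ?_
        simpa [MvPolynomial.eval_eq_eval_mv_eval'] using hy
      rw [← Set.biUnion_of_singleton ((fun y => (y, s)) ⁻¹' _)]
      exact (measure_biUnion_null_iff hfin.countable).2 fun y _ => hμ 0 y
    have := (measurePreserving_piFinSuccAbove μ 0).quasiMeasurePreserving.ae key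
    filter_upwards [this] with x hx
    simpa [MeasurableEquiv.piFinSuccAbove, Fin.insertNthEquiv, Fin.cons_self_tail] using hx

section

variable {Ω : Type*} [MeasurableSpace Ω] {P : Measure Ω}

theorem ae_eval_ne_zero [IsProbabilityMeasure P] {ι : Type*} [Fintype ι] {X : ι → Ω → ℂ}
    (hX : ∀ e, AEMeasurable (X e) P) (hind : iIndepFun X P)
    (hat : ∀ e z, P.map (X e) {z} = 0) (p : MvPolynomial ι ℂ) (hp : p ≠ 0) :
    ∀ᵐ ω ∂P, MvPolynomial.eval (fun e => X e ω) p ≠ 0 := by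
  let σ := Fintype.equivFin ι
  have hX' : ∀ e, AEMeasurable (X (σ.symm e)) P := fun e => hX _
  have hind' : iIndepFun (fun e => X (σ.symm e)) P := hind.precomp σ.symm.injective
  have hp' : MvPolynomial.rename σ p ≠ 0 := by
    rwa [Ne, map_eq_zero_iff _ (MvPolynomial.rename_injective _ σ.injective)]
  have : ∀ e, IsProbabilityMeasure (P.map (X (σ.symm e))) :=
    fun e => Measure.isProbabilityMeasure_map (hX' e)
  have h := ae_eval_ne_zero_fin (fun e => P.map (X (σ.symm e))) (fun e => hat _) _ hp'
  rw [← hind'.map_fun_eq_pi_map hX'] at h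
  have h2 := ae_of_ae_map (aemeasurable_pi_lambda _ hX') h
  filter_upwards [h2] with ω hω
  rw [MvPolynomial.eval_rename] at hω
  simpa [Function.comp_def] using hω

/-- A matrix whose entries are zero or distinct independent atomless random variables has almost
surely independent columns if its columns can be matched to rows along nonzero entries. -/
theorem ae_mulVec_injective [IsProbabilityMeasure P] {ι R C : Type*} [Fintype ι] [Fintype R] [Fintype C]
    {X : ι → Ω → ℂ}
    (hX : ∀ e, AEMeasurable (X e) P) (hind : iIndepFun X P)
    (hat : ∀ e z, P.map (X e) {z} = 0) (w : R → C → Option ι)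
    (hw : ∀ r c r' c' e, w r c = some e → w r' c' = some e → r = r' ∧ c = c')
    (f : C → R) (hf : Function.Injective f) (hfw : ∀ c, w (f c) c ≠ none) :
    ∀ᵐ ω ∂P, ∀ y : C → ℂ,
      (∀ r, ∑ c, (w r c).elim 0 (fun e => X e ω) * y c = 0) → y = 0 := by
  classical
  let p : MvPolynomial ι ℂ := (Matrix.of fun c' c : C =>
    (w (f c') c).elim (0 : MvPolynomial ι ℂ) MvPolynomial.X).det
  have heval : ∀ x : ι → ℂ, MvPolynomial.eval x p =
      (Matrix.of fun c' c : C => (w (f c') c).elim 0 x).det := by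
    intro x
    rw [RingHom.map_det]
    congr 1
    ext c' c
    simp only [RingHom.mapMatrix_apply, Matrix.map_apply, Matrix.of_apply]
    cases w (f c') c <;> simp
  have hp : p ≠ 0 := by
    intro h0
    -- Setting the matched entries to 1 and all others to 0 turns the square submatrix into the
    -- identity, because by `hw` and the injectivity of `f` no matched variable occurs off the
    -- diagonal.
    have h1 := heval fun e => if ∃ c, w (f c) c = some e then 1 else 0
    have h2 : (Matrix.of fun c' c : C => (w (f c') c).elim (0 : ℂ)
        fun e => if ∃ c, w (f c) c = some e then 1 else 0) = 1 := by
      ext c' c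
      rw [Matrix.of_apply]
      by_cases hcc : c' = c
      · subst hcc
        obtain ⟨e, he⟩ := Option.ne_none_iff_exists'.1 (hfw c')
        rw [he, Matrix.one_apply_eq, Option.elim_some, if_pos ⟨c', he⟩]
      · rw [Matrix.one_apply_ne hcc]
        cases he : w (f c') c with
        | none => rfl
        | some e =>
          rw [Option.elim_some, if_neg]
          rintro ⟨c'', hc''⟩
          obtain ⟨h3, h4⟩ := hw _ _ _ _ _ he hc''
          exact hcc ((hf h3).trans h4.symm)
    rw [h0, h2, map_zero, Matrix.det_one] at h1
    exact zero_ne_one h1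
  filter_upwards [ae_eval_ne_zero hX hind hat p hp] with ω hω y hy
  rw [heval] at hω
  refine Matrix.eq_zero_of_mulVec_eq_zero hω ?_
  ext c'
  exact hy (f c')

/-- Without circular symmetry the law may be concentrated on a real line. But the real and imaginary
parts are centred Gaussians and, by the unit variance, not both degenerate; the nondegenerate one
has no atoms. -/
theorem map_singleton_eq_zero {X : Ω → ℂ} (hX : HasGaussianLaw X P) (h0 : ∫ ω, X ω ∂P = 0)
    (h1 : ∫ ω, ‖X ω‖ ^ 2 ∂P = 1) (z : ℂ) : P.map X {z} = 0 := by
  have part : ∀ L : ℂ →L[ℝ] ℝ, P.map X {z} = 0 ∨ ∀ᵐ ω ∂P, L (X ω) = 0 := by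
    intro L
    have hL := hX.map_fun L
    have hmean : ∫ ω, L (X ω) ∂P = 0 := by
      rw [L.integral_comp_comm hX.integrable, h0, map_zero]
    have hm := hL.map_eq_gaussianReal
    rw [hmean] at hm
    by_cases hv : Var[fun ω => L (X ω); P].toNNReal = 0
    · right
      rw [hv, gaussianReal_zero_var] at hm
      have : ∀ᵐ x ∂(P.map fun ω => L (X ω)), x = 0 := by
        rw [hm, ae_dirac_eq]
        exact Filter.eventually_pure.2 rfl
      exact ae_of_ae_map hL.aemeasurable this
    · left
      have h2 : P.map (fun ω => L (X ω)) {L z} = 0 := by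
        rw [hm]
        have := nullSingletonClass_gaussianReal (μ := 0) hv
        exact measure_singleton _
      rw [Measure.map_apply_of_aemeasurable hL.aemeasurable (measurableSet_singleton _)] at h2
      rw [Measure.map_apply_of_aemeasurable hX.aemeasurable (measurableSet_singleton _)]
      refine measure_mono_null (fun ω hω => ?_) h2
      simp only [Set.mem_preimage, Set.mem_singleton_iff] at hω ⊢
      rw [hω]
  rcases part Complex.reCLM with h | hre
  · exact h
  rcases part Complex.imCLM with h | him
  · exact h
  exfalso
  have : ∫ ω, ‖X ω‖ ^ 2 ∂P = 0 := by
    rw [integral_congr_ae (g := fun _ => 0), integral_zero]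
    filter_upwards [hre, him] with ω hr hi
    have : X ω = 0 := Complex.ext hr hi
    simp [this]
  rw [this] at h1
  exact zero_ne_one h1

end

/-! ### Linear algebra of spans, decorrelators and square systems -/

/-- Vectors that are not separated from the column span of `A` by its left null vectors lie in it. -/
theorem mem_range_mulVecLin_of_forall {m n : Type*} [Fintype m] [Fintype n]
    (A : Matrix m n ℂ) (y : m → ℂ) (h : ∀ s : m → ℂ, Aᴴ *ᵥ s = 0 → star s ⬝ᵥ y = 0) :
    y ∈ LinearMap.range A.mulVecLin := by
  classical
  by_contra hy
  obtain ⟨g, hgy, hg⟩ := Submodule.exists_le_ker_of_notMem hy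
  let t : m → ℂ := fun a => g (Pi.single a 1)
  have ht : ∀ z, g z = t ⬝ᵥ z := by
    intro z
    conv_lhs => rw [pi_eq_sum_univ' z]
    simp [t, dotProduct, mul_comm]
  apply hgy
  rw [ht]
  have h2 := h (star t) ?_
  · rwa [star_star] at h2
  have h3 : t ᵥ* A = 0 := by
    ext c
    have : A *ᵥ Pi.single c 1 ∈ LinearMap.ker g := hg ⟨_, rfl⟩
    rw [LinearMap.mem_ker, ht, Matrix.dotProduct_mulVec] at this
    simpa using this
  rw [← Matrix.star_vecMul, h3, star_zero]

/-- If no nonzero combination of the columns of `A` lies in `W`, some matrix annihilates `W` and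
inverts `A` from the left. -/
theorem exists_decorrelator {m d : ℕ} (A : Matrix (Fin m) (Fin d) ℂ) (W : Submodule ℂ (Fin m → ℂ))
    (h : ∀ c, A *ᵥ c ∈ W → c = 0) :
    ∃ U : Matrix (Fin m) (Fin d) ℂ, Uᴴ * A = 1 ∧ ∀ w ∈ W, Uᴴ *ᵥ w = 0 := by
  -- `A` stays injective modulo `W`; a left inverse of the induced map, composed with the quotient
  -- map, is the required `Uᴴ`.
  have hk : LinearMap.ker (W.mkQ ∘ₗ A.mulVecLin) = ⊥ := by
    rw [LinearMap.ker_eq_bot']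
    intro c hc
    exact h c (by simpa using hc)
  obtain ⟨g, hg⟩ := LinearMap.exists_leftInverse_of_injective _ hk
  refine ⟨(LinearMap.toMatrix' (g ∘ₗ W.mkQ))ᴴ, ?_, fun w hw => ?_⟩
  · rw [Matrix.conjTranspose_conjTranspose]
    apply Matrix.toLin'.injective
    rw [Matrix.toLin'_mul, Matrix.toLin'_toMatrix', Matrix.toLin'_one, LinearMap.comp_assoc]
    exact hg
  · rw [Matrix.conjTranspose_conjTranspose, LinearMap.toMatrix'_mulVec, LinearMap.comp_apply]
    rw [Submodule.mkQ_apply, (Submodule.Quotient.mk_eq_zero W).2 hw, map_zero]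

section Square

variable {E : Type*} [AddCommGroup E] [Module ℂ E] [FiniteDimensional ℂ E] {K d : ℕ}
  {Q : Fin K → Type*} [∀ k, AddCommGroup (Q k)] [∀ k, Module ℂ (Q k)]
  [∀ k, FiniteDimensional ℂ (Q k)]

/-- Source and product both have dimension `K * d`, so joint injectivity forces joint surjectivity.
-/
theorem pi_surjective_of_finrank (hE : Module.finrank ℂ E = K * d)
    (hQ : ∀ k, Module.finrank ℂ (Q k) = d) (φ : ∀ k, E →ₗ[ℂ] Q k)
    (hφ : ∀ x, (∀ k, φ k x = 0) → x = 0) : Function.Surjective (LinearMap.pi φ) := by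
  rw [← LinearMap.injective_iff_surjective_of_finrank_eq_finrank]
  · rw [← LinearMap.ker_eq_bot, LinearMap.ker_eq_bot']
    exact fun x hx => hφ x fun k => congrFun hx k
  · rw [hE, Module.finrank_pi_fintype]
    simp [hQ]

theorem finrank_ker_of_finrank (hE : Module.finrank ℂ E = K * d)
    (hQ : ∀ k, Module.finrank ℂ (Q k) = d) (φ : ∀ k, E →ₗ[ℂ] Q k)
    (hφ : ∀ x, (∀ k, φ k x = 0) → x = 0) (k : Fin K) :
    Module.finrank ℂ (LinearMap.ker (φ k)) + d = K * d := by
  have hs : Function.Surjective (φ k) := by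
    intro q
    obtain ⟨x, hx⟩ := pi_surjective_of_finrank hE hQ φ hφ (Pi.single k q)
    exact ⟨x, by simpa using congrFun hx k⟩
  have := (φ k).finrank_range_add_finrank_ker
  rw [LinearMap.range_eq_top.2 hs, finrank_top, hQ, hE] at this
  omega

/-- The joint map is invertible, and the preimage of its `p`-th summand is a `d`-dimensional space
on which every other `φ k` vanishes. -/
theorem exists_injective_of_finrank (hE : Module.finrank ℂ E = K * d)
    (hQ : ∀ k, Module.finrank ℂ (Q k) = d) (φ : ∀ k, E →ₗ[ℂ] Q k)
    (hφ : ∀ x, (∀ k, φ k x = 0) → x = 0) (p : Fin K) :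
    ∃ V : (Fin d → ℂ) →ₗ[ℂ] E, Function.Injective V ∧ ∀ c k, k ≠ p → φ k (V c) = 0 := by
  obtain ⟨g, hg⟩ := LinearMap.exists_rightInverse_of_surjective (LinearMap.pi φ)
    (LinearMap.range_eq_top.2 (pi_surjective_of_finrank hE hQ φ hφ))
  have hd : Module.finrank ℂ (Fin d → ℂ) = Module.finrank ℂ (Q p) := by simp [hQ]
  have hg' : ∀ q, LinearMap.pi φ (g q) = q := fun q => LinearMap.congr_fun hg q
  refine ⟨g ∘ₗ LinearMap.single ℂ Q p ∘ₗ (LinearEquiv.ofFinrankEq _ _ hd).toLinearMap, ?_, ?_⟩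
  · have hinj : Function.Injective g := Function.LeftInverse.injective hg'
    exact hinj.comp ((Pi.single_injective p).comp (LinearEquiv.injective _))
  · intro c k hk
    have := congrFun (hg' (Pi.single p (LinearEquiv.ofFinrankEq _ _ hd c))) k
    rw [Pi.single_eq_of_ne hk] at this
    exact this

end Square

/-! ### Concatenated links, interference spans and the reduction of alignment -/

namespace FeedbackProfile

variable {K : ℕ} {M N : Fin K → ℕ} (L : FeedbackProfile K M N)

/-- The concatenation of the matrices `H_{ji}^s` for the links `i ∈ S`. -/
def linkConcat (S : Finset (Fin K)) (j : Fin K) (G : ∀ i, Matrix (Fin (M j)) (Fin (N i)) ℂ) :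
    Matrix (Fin (L.Ms j)) (Σ i : {i // i ∈ S}, Fin (L.Ns i.1)) ℂ :=
  Matrix.of fun a c => L.sub j G c.1.1 a c.2

theorem linkConcat_mulVec (S : Finset (Fin K)) (j : Fin K)
    (G : ∀ i, Matrix (Fin (M j)) (Fin (N i)) ℂ)
    (y : (Σ i : {i // i ∈ S}, Fin (L.Ns i.1)) → ℂ) :
    L.linkConcat S j G *ᵥ y = ∑ i : {i // i ∈ S}, L.sub j G i.1 *ᵥ fun b => y ⟨i, b⟩ := by
  ext a
  simp [Matrix.mulVec, dotProduct, linkConcat, Fintype.sum_sigma]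

theorem linkConcat_mulVec_restrict (S : Finset (Fin K)) (j : Fin K)
    (G : ∀ i, Matrix (Fin (M j)) (Fin (N i)) ℂ) (z : ∀ i, Fin (L.Ns i) → ℂ) :
    (L.linkConcat S j G *ᵥ fun c => z c.1.1 c.2) = ∑ i ∈ S, L.sub j G i *ᵥ z i := by
  rw [linkConcat_mulVec]
  exact Finset.sum_coe_sort S fun i => L.sub j G i *ᵥ z i

theorem mem_range_linkConcat_iff (S : Finset (Fin K)) (j : Fin K)
    (G : ∀ i, Matrix (Fin (M j)) (Fin (N i)) ℂ) (w : Fin (L.Ms j) → ℂ) :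
    w ∈ LinearMap.range (L.linkConcat S j G).mulVecLin ↔
      ∃ z : ∀ i, Fin (L.Ns i) → ℂ, ∑ i ∈ S, L.sub j G i *ᵥ z i = w := by
  constructor
  · rintro ⟨y, rfl⟩
    refine ⟨fun i b => if h : i ∈ S then y ⟨⟨i, h⟩, b⟩ else 0, ?_⟩
    rw [← linkConcat_mulVec_restrict]
    simp
  · rintro ⟨z, rfl⟩
    exact ⟨_, L.linkConcat_mulVec_restrict S j G z⟩

theorem sub_mulVec_mem_range_linkConcat {S : Finset (Fin K)} {i : Fin K} (hi : i ∈ S) (j : Fin K)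
    (G : ∀ i, Matrix (Fin (M j)) (Fin (N i)) ℂ) (x : Fin (L.Ns i) → ℂ) :
    L.sub j G i *ᵥ x ∈ LinearMap.range (L.linkConcat S j G).mulVecLin := by
  rw [mem_range_linkConcat_iff]
  refine ⟨Pi.single i x, ?_⟩
  rw [Finset.sum_eq_single i]
  · rw [Pi.single_eq_same]
  · intro k _ hk
    rw [Pi.single_eq_of_ne hk, Matrix.mulVec_zero]
  · exact fun h => absurd hi h

/-- This is zero-forcing: independence of all columns separates the block of link `i` from the span
of the others. -/
theorem eq_zero_of_mem_range_linkConcat {S : Finset (Fin K)} {i : Fin K} (hi : i ∈ S) (j : Fin K)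
    (G : ∀ i, Matrix (Fin (M j)) (Fin (N i)) ℂ)
    (hS : ∀ y, L.linkConcat S j G *ᵥ y = 0 → y = 0) (x : Fin (L.Ns i) → ℂ)
    (hx : L.sub j G i *ᵥ x ∈ LinearMap.range (L.linkConcat (S.erase i) j G).mulVecLin) :
    x = 0 := by
  obtain ⟨z, hz⟩ := (L.mem_range_linkConcat_iff _ j G _).1 hx
  have h := hS (fun c => Function.update (-z) i x c.1.1 c.2) ?_
  · ext b
    simpa using congrFun h ⟨⟨i, hi⟩, b⟩
  · rw [linkConcat_mulVec_restrict, ← Finset.add_sum_erase _ _ hi, Function.update_self, ← hz,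
      ← Finset.sum_add_distrib]
    refine Finset.sum_eq_zero fun k hk => ?_
    rw [Function.update_of_ne (Finset.ne_of_mem_erase hk), Pi.neg_apply, Matrix.mulVec_neg,
      add_neg_cancel]

/-- The span of the columns of `H_{ji}^s`, `i ∈ Ω_j^II`. -/
def interferenceSpan (j : Fin K) (G : ∀ i, Matrix (Fin (M j)) (Fin (N i)) ℂ) :
    Submodule ℂ (Fin (L.Ms j) → ℂ) :=
  LinearMap.range (L.linkConcat (L.link .II j) j G).mulVecLin

theorem mem_leftNull_iff (j : Fin K) (G : ∀ i, Matrix (Fin (M j)) (Fin (N i)) ℂ)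
    (s : Fin (L.Ms j) → ℂ) :
    s ∈ L.leftNull j G ↔ (L.linkConcat (L.link .II j) j G)ᴴ *ᵥ s = 0 := by
  simp only [leftNull, Submodule.mem_iInf, LinearMap.mem_ker, Matrix.mulVecLin_apply]
  constructor
  · intro h
    ext c
    exact congrFun (h c.1.1 c.1.2) c.2
  · intro h i hi
    ext b
    exact congrFun h ⟨⟨i, hi⟩, b⟩

/-- By double annihilation, the left null vectors detect exactly the interference span. The fed back
null space thus consists of the beams aligned with strategy-II interference. -/
theorem mem_nullFeedback_iff (j : Fin K) (G : ∀ i, Matrix (Fin (M j)) (Fin (N i)) ℂ) (p : Fin K)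
    (x : Fin (L.Ns p) → ℂ) :
    x ∈ L.nullFeedback j G p ↔ L.sub j G p *ᵥ x ∈ L.interferenceSpan j G := by
  change (∀ s ∈ L.leftNull j G, star s ⬝ᵥ (L.sub j G p *ᵥ x) = 0) ↔ _
  constructor
  · intro h
    refine mem_range_mulVecLin_of_forall _ _ fun s hs => h s ((L.mem_leftNull_iff j G s).2 hs)
  · rintro ⟨y, hy⟩ s hs
    rw [← hy, Matrix.mulVecLin_apply, Matrix.dotProduct_mulVec]
    have := congrArg star ((L.mem_leftNull_iff j G s).1 hs)
    rw [Matrix.star_mulVec, Matrix.conjTranspose_conjTranspose, star_zero] at this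
    rw [this, zero_dotProduct]

theorem finrank_quotient_interferenceSpan (j : Fin K)
    (G : ∀ i, Matrix (Fin (M j)) (Fin (N i)) ℂ) {e : ℕ}
    (he : ∑ i ∈ L.link .II j, L.Ns i + e = L.Ms j)
    (hG : ∀ y, L.linkConcat (L.link .II j) j G *ᵥ y = 0 → y = 0) :
    Module.finrank ℂ ((Fin (L.Ms j) → ℂ) ⧸ L.interferenceSpan j G) = e := by
  have h1 := (L.interferenceSpan j G).finrank_quotient_add_finrank
  have h2 : Module.finrank ℂ (L.interferenceSpan j G) = ∑ i ∈ L.link .II j, L.Ns i := by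
    rw [interferenceSpan, LinearMap.finrank_range_of_inj]
    · rw [Module.finrank_fintype_fun_eq_card, Fintype.card_sigma]
      simp only [Fintype.card_fin]
      exact Finset.sum_coe_sort (L.link .II j) L.Ns
    · rw [← LinearMap.ker_eq_bot, LinearMap.ker_eq_bot']
      exact hG
  rw [h2, Module.finrank_fintype_fun_eq_card, Fintype.card_fin] at h1
  omega

/-- Extension by zero of a vector on the first `N_i^s` transmit antennas. -/
def extend (i : Fin K) {d : ℕ} (V : Matrix (Fin (L.Ns i)) (Fin d) ℂ) :
    Matrix (Fin (N i)) (Fin d) ℂ :=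
  Matrix.of fun b c => if h : (b : ℕ) < L.Ns i then V ⟨b, h⟩ c else 0

theorem mul_extend_castLE (j i : Fin K) (G : ∀ i, Matrix (Fin (M j)) (Fin (N i)) ℂ) {d : ℕ}
    (V : Matrix (Fin (L.Ns i)) (Fin d) ℂ) (a : Fin (L.Ms j)) (c : Fin d) :
    (G i * L.extend i V) (Fin.castLE (L.Ms_le j) a) c = (L.sub j G i * V) a c := by
  rw [Matrix.mul_apply, Matrix.mul_apply]
  symm
  refine Finset.sum_of_injOn (Fin.castLE (L.Ns_le i)) (Fin.castLE_injective _).injOn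
    (fun _ _ => Finset.mem_coe.2 (Finset.mem_univ _)) ?_ ?_
  · intro b _ hb
    have : ¬ (b : ℕ) < L.Ns i := fun h => hb ⟨⟨b, h⟩, by simp, rfl⟩
    simp [extend, this]
  · intro b _
    simp [extend, sub]

/-- Alignment inside prescribed interference subspaces of the first `M_j^s` receive antennas
is enough for a profile to achieve interference alignment. -/
theorem achievesIA_of_ae {Ω : Type*} [MeasurableSpace Ω] {P : Measure Ω}
    {H : Ω → Channel K M N} {d : ℕ}
    (v : (∀ j, L.Feedback j) → ∀ i, Matrix (Fin (L.Ns i)) (Fin d) ℂ)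
    (h : ∀ᵐ ω ∂P, ∀ j, ∃ W : Submodule ℂ (Fin (L.Ms j) → ℂ),
      (∀ i, i ≠ j → ∀ c, L.sub j (H ω j) i *ᵥ
        (v (fun j => L.feedback j (H ω j)) i *ᵥ c) ∈ W) ∧
      ∀ c, L.sub j (H ω j) j *ᵥ (v (fun j => L.feedback j (H ω j)) j *ᵥ c) ∈ W → c = 0) :
    L.AchievesIA (fun _ => d) P H := by
  classical
  -- The decorrelator is chosen from the products `B i = H_{ji} V_i` alone; the default 0 is almost
  -- surely never used.
  refine ⟨fun F i => L.extend i (v F i), fun j B =>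
    if hU : ∃ U : Matrix (Fin (M j)) (Fin d) ℂ, Uᴴ * B j = 1 ∧ ∀ i, i ≠ j → Uᴴ * B i = 0
    then hU.choose else 0, ?_⟩
  filter_upwards [h] with ω hω
  dsimp only
  have key : ∀ j, ∃ U : Matrix (Fin (M j)) (Fin d) ℂ,
      Uᴴ * (H ω j j * L.extend j (v (fun j => L.feedback j (H ω j)) j)) = 1 ∧
      ∀ i, i ≠ j → Uᴴ * (H ω j i * L.extend i (v (fun j => L.feedback j (H ω j)) i)) = 0 := by
    intro j
    obtain ⟨W, hW1, hW2⟩ := hω j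
    -- `ρ` keeps the first `M_j^s` antennas. Its kernel lies in `W.comap ρ`, so a `U` that
    -- annihilates this preimage ignores the remaining antennas.
    let ρ : (Fin (M j) → ℂ) →ₗ[ℂ] (Fin (L.Ms j) → ℂ) :=
      LinearMap.funLeft ℂ ℂ (Fin.castLE (L.Ms_le j))
    have hρ : ∀ i c, ρ ((H ω j i * L.extend i (v (fun j => L.feedback j (H ω j)) i)) *ᵥ c) =
        L.sub j (H ω j) i *ᵥ (v (fun j => L.feedback j (H ω j)) i *ᵥ c) := by
      intro i c
      ext a
      rw [Matrix.mulVec_mulVec, LinearMap.funLeft_apply]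
      simp only [Matrix.mulVec, dotProduct]
      exact Finset.sum_congr rfl fun b _ => by rw [mul_extend_castLE]
    obtain ⟨U, hU1, hU2⟩ := exists_decorrelator
      (H ω j j * L.extend j (v (fun j => L.feedback j (H ω j)) j)) (W.comap ρ)
      fun c hc => hW2 c (by rw [← hρ]; exact hc)
    refine ⟨U, hU1, fun i hi => ?_⟩
    apply Matrix.toLin'.injective
    refine LinearMap.ext fun c => ?_
    rw [Matrix.toLin'_apply, ← Matrix.mulVec_mulVec, map_zero, LinearMap.zero_apply]
    refine hU2 _ ?_
    rw [Submodule.mem_comap, hρ]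
    exact hW1 i hi c
  refine ⟨fun j => ?_, fun i j hij => ?_⟩
  · rw [dif_pos (key j), Matrix.mul_assoc, (key j).choose_spec.1, Matrix.rank_one,
      Fintype.card_fin]
  · rw [dif_pos (key j), Matrix.mul_assoc, (key j).choose_spec.2 i hij]

end FeedbackProfile

theorem IsGaussianChannel.ae_mulVec_injective {K : ℕ} {M N : Fin K → ℕ} {Ω : Type*}
    [MeasurableSpace Ω] {P : Measure Ω} [IsProbabilityMeasure P] {H : Ω → Channel K M N}
    (hH : IsGaussianChannel P H) {R C : Type*} [Fintype R] [Fintype C]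
    (w : R → C → Option (Σ p : Fin K × Fin K, Fin (M p.1) × Fin (N p.2)))
    (hw : ∀ r c r' c' e, w r c = some e → w r' c' = some e → r = r' ∧ c = c')
    (f : C → R) (hf : Function.Injective f) (hfw : ∀ c, w (f c) c ≠ none) :
    ∀ᵐ ω ∂P, ∀ y : C → ℂ,
      (∀ r, ∑ c, (w r c).elim 0 (fun e => H ω e.1.1 e.1.2 e.2.1 e.2.2) * y c = 0) → y = 0 :=
  InterferenceNetwork.ae_mulVec_injective (fun _ => (hH.gaussian _ _ _ _).aemeasurable) hH.indep
    (fun _ => map_singleton_eq_zero (hH.gaussian _ _ _ _) (hH.mean_zero _ _ _ _)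
      (hH.variance_one _ _ _ _)) w hw f hf hfw

/-! ### Almost sure independence of channel blocks -/

namespace FeedbackProfile

variable {K : ℕ} {M N : Fin K → ℕ} (L : FeedbackProfile K M N) {Ω : Type*} [MeasurableSpace Ω]
  {P : Measure Ω} [IsProbabilityMeasure P] {H : Ω → Channel K M N}

/-- The position in the channel of an entry of `H_{ji}^s`. -/
def entry (j i : Fin K) (a : Fin (L.Ms j)) (b : Fin (L.Ns i)) :
    Σ p : Fin K × Fin K, Fin (M p.1) × Fin (N p.2) :=
  ⟨(j, i), Fin.castLE (L.Ms_le j) a, Fin.castLE (L.Ns_le i) b⟩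

theorem entry_inj {j i : Fin K} {a : Fin (L.Ms j)} {b : Fin (L.Ns i)}
    {j' i' : Fin K} {a' : Fin (L.Ms j')} {b' : Fin (L.Ns i')}
    (h : L.entry j i a b = L.entry j' i' a' b') :
    (⟨j, a⟩ : Σ j, Fin (L.Ms j)) = ⟨j', a'⟩ ∧ (⟨i, b⟩ : Σ i, Fin (L.Ns i)) = ⟨i', b'⟩ := by
  obtain ⟨h1, h2⟩ := Sigma.mk.inj h
  obtain ⟨rfl, rfl⟩ := Prod.mk.inj h1
  obtain ⟨h3, h4⟩ := Prod.mk.inj (eq_of_heq h2)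
  rw [Fin.castLE_injective _ h3, Fin.castLE_injective _ h4]
  exact ⟨rfl, rfl⟩

/-- Jointly used links do not overload a receiver that has enough antennas. -/
theorem ae_linkConcat_injective (hH : IsGaussianChannel P H) (S : Finset (Fin K)) (j : Fin K)
    (hS : ∑ i ∈ S, L.Ns i ≤ L.Ms j) :
    ∀ᵐ ω ∂P, ∀ y, L.linkConcat S j (H ω j) *ᵥ y = 0 → y = 0 := by
  obtain ⟨f⟩ : Nonempty ((Σ i : {i // i ∈ S}, Fin (L.Ns i.1)) ↪ Fin (L.Ms j)) := by
    refine Function.Embedding.nonempty_of_card_le ?_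
    rw [Fintype.card_sigma, Fintype.card_fin]
    simp only [Fintype.card_fin]
    rwa [Finset.sum_coe_sort S L.Ns]
  refine (hH.ae_mulVec_injective
    (fun a (c : Σ i : {i // i ∈ S}, Fin (L.Ns i.1)) => some (L.entry j c.1.1 a c.2)) ?_ f
    f.injective (fun c => Option.some_ne_none _)).mono fun ω hω y hy => ?_
  rotate_left
  · exact hω y fun a => congrFun hy a
  · rintro a ⟨i, b⟩ a' ⟨i', b'⟩ e h1 h2
    obtain ⟨h3, h4⟩ := L.entry_inj (Option.some.inj (h1.trans h2.symm))
    refine ⟨eq_of_heq (Sigma.mk.inj h3).2, ?_⟩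
    obtain ⟨h5, h6⟩ := Sigma.mk.inj h4
    obtain rfl := Subtype.ext h5
    have h7 : b = b' := eq_of_heq h6
    rw [h7]

/-- If `N_p^s` does not exceed the total number of dimensions that are left free by the
strategy-II interference at all receivers, no nonzero beam of transmitter `p` is aligned with that
interference at every receiver. -/
theorem ae_eq_zero_of_aligned (hH : IsGaussianChannel P H) (p : Fin K)
    (hp : ∀ k, p ∉ L.link .II k) (e : Fin K → ℕ)
    (he : ∀ k, ∑ i ∈ L.link .II k, L.Ns i + e k ≤ L.Ms k) (hpe : L.Ns p ≤ ∑ k, e k) :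
    ∀ᵐ ω ∂P, ∀ x, (∀ k, L.sub k (H ω k) p *ᵥ x ∈ L.interferenceSpan k (H ω k)) → x = 0 := by
  obtain ⟨g⟩ : Nonempty (Fin (L.Ns p) ↪ Σ k, Fin (e k)) := by
    refine Function.Embedding.nonempty_of_card_le ?_
    simpa using hpe
  have hf : ∀ k, Nonempty
      ((Σ i : {i // i ∈ L.link .II k}, Fin (L.Ns i.1)) ⊕ Fin (e k) ↪ Fin (L.Ms k)) := by
    intro k
    refine Function.Embedding.nonempty_of_card_le ?_
    rw [Fintype.card_sum, Fintype.card_sigma, Fintype.card_fin]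
    simp only [Fintype.card_fin]
    rw [Finset.sum_coe_sort (L.link .II k) L.Ns]
    exact he k
  let f := fun k => (hf k).some
  -- The systems of all receivers are stacked: the columns for `x` meet every receiver's rows, while
  -- the columns for the interference coefficients of receiver `k` meet only its own rows.
  let w : (Σ k, Fin (L.Ms k)) →
      (Fin (L.Ns p) ⊕ Σ k, Σ i : {i // i ∈ L.link .II k}, Fin (L.Ns i.1)) →
      Option (Σ p : Fin K × Fin K, Fin (M p.1) × Fin (N p.2)) := fun r c =>
    c.elim (fun b => some (L.entry r.1 p r.2 b))
      fun z => if r.1 = z.1 then some (L.entry r.1 z.2.1.1 r.2 z.2.2) else none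
  -- Interference columns are matched to rows of their own receiver; the columns of `x` are spread
  -- by `g` over the `e k` rows left free at each receiver `k`.
  let F : (Fin (L.Ns p) ⊕ Σ k, Σ i : {i // i ∈ L.link .II k}, Fin (L.Ns i.1)) →
      Σ k, Fin (L.Ms k) :=
    Sum.elim (fun b => ⟨(g b).1, f _ (Sum.inr (g b).2)⟩) fun z => ⟨z.1, f _ (Sum.inl z.2)⟩
  have hF : Function.Injective F := by
    rintro (b | ⟨k, z⟩) (b' | ⟨k', z'⟩) h
    · obtain ⟨h1, h2⟩ := Sigma.mk.inj h
      congr 1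
      apply g.injective
      revert h1 h2
      generalize g b = q
      generalize g b' = q'
      obtain ⟨k, c⟩ := q
      obtain ⟨k', c'⟩ := q'
      rintro h1 h2
      dsimp only at h1
      subst h1
      have := Sum.inr.inj ((f k).injective (eq_of_heq h2))
      simpa using this
    · obtain ⟨h1, h2⟩ := Sigma.mk.inj h
      subst h1
      exact absurd ((f _).injective (eq_of_heq h2)) Sum.inr_ne_inl
    · obtain ⟨h1, h2⟩ := Sigma.mk.inj h
      subst h1
      exact absurd ((f _).injective (eq_of_heq h2)) Sum.inl_ne_inr
    · obtain ⟨h1, h2⟩ := Sigma.mk.inj h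
      subst h1
      have h3 : z = z' := Sum.inl.inj ((f _).injective (eq_of_heq h2))
      rw [h3]
  refine (hH.ae_mulVec_injective w ?_ F hF ?_).mono fun ω hω x hx => ?_
  rotate_right
  · choose z hz using hx
    have h0 := hω (Sum.elim x fun c => - z c.1 c.2) ?_
    · ext b
      exact congrFun h0 (Sum.inl b)
    · rintro ⟨k, a⟩
      have hk := congrFun (hz k) a
      rw [Fintype.sum_sum_type, Fintype.sum_sigma, Finset.sum_eq_single k]
      · simp only [w, Sum.elim_inl, Sum.elim_inr, Option.elim_some, if_true, mul_neg,
          Finset.sum_neg_distrib]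
        rw [← sub_eq_add_neg, sub_eq_zero]
        exact hk.symm
      · intro k' _ hk'
        refine Finset.sum_eq_zero fun c _ => ?_
        simp [w, hk'.symm]
      · exact fun h => absurd (Finset.mem_univ _) h
  · rintro ⟨k, a⟩ c ⟨k', a'⟩ c' q h1 h2
    have hsome : ∀ (r : Σ k, Fin (L.Ms k)) (z : Σ k, Σ i : {i // i ∈ L.link .II k},
        Fin (L.Ns i.1)), w r (Sum.inr z) = some q →
        r.1 = z.1 ∧ L.entry r.1 z.2.1.1 r.2 z.2.2 = q := by
      intro r z h
      simp only [w, Sum.elim_inr] at h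
      split_ifs at h with hr
      exact ⟨hr, Option.some.inj h⟩
    rcases c with b | ⟨l, ⟨i, hi⟩, b⟩ <;> rcases c' with b' | ⟨l', ⟨i', hi'⟩, b'⟩
    · obtain ⟨h3, h4⟩ := L.entry_inj (Option.some.inj (h1.trans h2.symm))
      have h7 : b = b' := eq_of_heq (Sigma.mk.inj h4).2
      exact ⟨h3, by rw [h7]⟩
    -- As `p` is never a strategy-II link, the `x` block shares no variable with the interference
    -- blocks.
    · obtain ⟨-, h5⟩ := hsome _ _ h2
      obtain ⟨-, h4⟩ := L.entry_inj ((Option.some.inj h1).trans h5.symm)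
      have h6 : p = i' := (Sigma.mk.inj h4).1
      exact absurd (h6.symm ▸ hi') (hp _)
    · obtain ⟨-, h5⟩ := hsome _ _ h1
      obtain ⟨-, h4⟩ := L.entry_inj ((Option.some.inj h2).trans h5.symm)
      have h6 : p = i := (Sigma.mk.inj h4).1
      exact absurd (h6.symm ▸ hi) (hp _)
    · obtain ⟨h6, h5⟩ := hsome _ _ h1
      obtain ⟨h6', h5'⟩ := hsome _ _ h2
      obtain ⟨h3, h4⟩ := L.entry_inj (h5.trans h5'.symm)
      dsimp only at h6 h6'
      subst h6 h6'
      obtain rfl := (Sigma.mk.inj h3).1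
      obtain rfl := (Sigma.mk.inj h4).1
      have h7 : b = b' := eq_of_heq (Sigma.mk.inj h4).2
      exact ⟨h3, by rw [h7]⟩
  · rintro (b | z) <;> simp [w, F]

end FeedbackProfile

/-! ### Precoders from fed back null spaces, and the feedback dimension -/

namespace FeedbackProfile

variable {K : ℕ} {M N : Fin K → ℕ} (L : FeedbackProfile K M N)

theorem exists_mulVec_injective {d n : ℕ} (h : d ≤ n) :
    ∃ V : Matrix (Fin n) (Fin d) ℂ, ∀ c, V *ᵥ c = 0 → c = 0 := by
  refine ⟨Matrix.of fun b c => if b = Fin.castLE h c then 1 else 0, fun c hc => ?_⟩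
  ext i
  have := congrFun hc (Fin.castLE h i)
  simpa [Matrix.mulVec, dotProduct] using this

/-- Precoders that are computed from the fed back null spaces: the columns of the `i`-th precoder
are independent and lie in all null spaces that are fed back for transmitter `i`, if possible. -/
noncomputable def nullPrecoder (d : ℕ) (F : ∀ j, L.Feedback j) (i : Fin K) :
    Matrix (Fin (L.Ns i)) (Fin d) ℂ :=
  open Classical in
  if h : ∃ V : Matrix (Fin (L.Ns i)) (Fin d) ℂ, (∀ c, V *ᵥ c = 0 → c = 0) ∧
      ∀ j (hj : i ∈ L.link .III j) c, V *ᵥ c ∈ (F j).1 ⟨i, hj⟩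
  then h.choose else 0

theorem nullPrecoder_spec {d : ℕ} {G : Channel K M N} {i : Fin K}
    (h : ∃ V : Matrix (Fin (L.Ns i)) (Fin d) ℂ, (∀ c, V *ᵥ c = 0 → c = 0) ∧
      ∀ j, i ∈ L.link .III j → ∀ c, L.sub j (G j) i *ᵥ (V *ᵥ c) ∈ L.interferenceSpan j (G j)) :
    (∀ c, L.nullPrecoder d (fun j => L.feedback j (G j)) i *ᵥ c = 0 → c = 0) ∧
      ∀ j, i ∈ L.link .III j → ∀ c,
        L.sub j (G j) i *ᵥ (L.nullPrecoder d (fun j => L.feedback j (G j)) i *ᵥ c) ∈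
          L.interferenceSpan j (G j) := by
  have h' : ∃ V : Matrix (Fin (L.Ns i)) (Fin d) ℂ, (∀ c, V *ᵥ c = 0 → c = 0) ∧
      ∀ j (hj : i ∈ L.link .III j) c, V *ᵥ c ∈ (L.feedback j (G j)).1 ⟨i, hj⟩ := by
    obtain ⟨V, hV1, hV2⟩ := h
    exact ⟨V, hV1, fun j hj c => (L.mem_nullFeedback_iff j (G j) i _).2 (hV2 j hj c)⟩
  have hs := h'.choose_spec
  rw [nullPrecoder, dif_pos h']
  exact ⟨hs.1, fun j hj c => (L.mem_nullFeedback_iff j (G j) i _).1 (hs.2 j hj c)⟩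

theorem realizedDimension_eq (hIV : ∀ j, L.link .IV j = ∅) (G : Channel K M N) :
    L.realizedDimension G =
      ∑ j, ∑ p : {p // p ∈ L.link .III j}, grassmannDim (L.nullFeedback j (G j) p.1) := by
  refine Finset.sum_congr rfl fun j _ => ?_
  have hempty : IsEmpty (L.ConcatIndex j) := ⟨fun c => by
    have h := hIV j
    exact Finset.notMem_empty c.1.1 (h ▸ c.1.2)⟩
  have h0 : grassmannDim (L.feedback j (G j)).2 = 0 := by
    rw [grassmannDim, Module.finrank_zero_of_subsingleton]
    simp
  rw [h0, add_zero]
  rfl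

variable {Ω : Type*} [MeasurableSpace Ω] {P : Measure Ω} [IsProbabilityMeasure P]
  {H : Ω → Channel K M N}

/-- Without any feedback, alignment is achieved if no receiver is overloaded. -/
theorem achievesIA_of_sum_le (hH : IsGaussianChannel P H) {d : ℕ} (hIII : ∀ j, L.link .III j = ∅)
    (hNs : ∀ i, d ≤ L.Ns i) (hsum : ∀ j, ∑ i, L.Ns i ≤ L.Ms j) :
    L.AchievesIA (fun _ => d) P H := by
  refine L.achievesIA_of_ae (fun F i => L.nullPrecoder d F i) ?_
  filter_upwards [ae_all_iff.2 fun j => L.ae_linkConcat_injective hH Finset.univ j (hsum j)]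
    with ω hω j
  have hV := fun i => (L.nullPrecoder_spec (d := d) (G := H ω) (i := i) (by
    obtain ⟨V, hV⟩ := exists_mulVec_injective (hNs i)
    exact ⟨V, hV, fun j hj => by simp [hIII j] at hj⟩)).1
  refine ⟨LinearMap.range (L.linkConcat (Finset.univ.erase j) j (H ω j)).mulVecLin, ?_, ?_⟩
  · exact fun i hi c => L.sub_mulVec_mem_range_linkConcat
      (Finset.mem_erase.2 ⟨hi, Finset.mem_univ i⟩) j _ _
  · exact fun c hc => hV j c
      (L.eq_zero_of_mem_range_linkConcat (Finset.mem_univ j) j _ (hω j) _ hc)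

theorem grassmannDim_nullFeedback {d : ℕ} {G : Channel K M N} {p : Fin K}
    (hMe : ∀ k, ∑ i ∈ L.link .II k, L.Ns i + d = L.Ms k) (hp : L.Ns p = K * d)
    (hII : ∀ k y, L.linkConcat (L.link .II k) k (G k) *ᵥ y = 0 → y = 0)
    (hal : ∀ x, (∀ k, L.sub k (G k) p *ᵥ x ∈ L.interferenceSpan k (G k)) → x = 0)
    (j : Fin K) :
    grassmannDim (L.nullFeedback j (G j) p) = d * ((K : ℤ) * d - d) := by
  have h := finrank_ker_of_finrank (E := Fin (L.Ns p) → ℂ) (d := d) (by simp [hp])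
    (fun k => L.finrank_quotient_interferenceSpan k (G k) (hMe k) (hII k))
    (fun k => (L.interferenceSpan k (G k)).mkQ ∘ₗ (L.sub k (G k) p).mulVecLin)
    (fun x hx => hal x fun k => by simpa using hx k) j
  have h2 : LinearMap.ker ((L.interferenceSpan j (G j)).mkQ ∘ₗ (L.sub j (G j) p).mulVecLin) =
      L.nullFeedback j (G j) p := by
    ext x
    rw [mem_nullFeedback_iff]
    simp
  rw [h2] at h
  have h3 : (Module.finrank ℂ (L.nullFeedback j (G j) p) : ℤ) = K * d - d := by
    have : (Module.finrank ℂ (L.nullFeedback j (G j) p) : ℤ) + d = K * d := by exact_mod_cast h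
    linarith
  rw [grassmannDim, h3, Fintype.card_fin, hp]
  push_cast
  ring

/-- Modulo the interference spans, the links from `p` form a square jointly injective system, so
alignment at all receivers but `p` still leaves `d` dimensions. -/
theorem exists_aligned_precoder {d : ℕ} {G : Channel K M N} {p : Fin K}
    (hMe : ∀ k, ∑ i ∈ L.link .II k, L.Ns i + d = L.Ms k) (hp : L.Ns p = K * d)
    (hII : ∀ k y, L.linkConcat (L.link .II k) k (G k) *ᵥ y = 0 → y = 0)
    (hal : ∀ x, (∀ k, L.sub k (G k) p *ᵥ x ∈ L.interferenceSpan k (G k)) → x = 0) :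
    ∃ V : Matrix (Fin (L.Ns p)) (Fin d) ℂ, (∀ c, V *ᵥ c = 0 → c = 0) ∧
      ∀ j, j ≠ p → ∀ c, L.sub j (G j) p *ᵥ (V *ᵥ c) ∈ L.interferenceSpan j (G j) := by
  obtain ⟨V, hV1, hV2⟩ := exists_injective_of_finrank (E := Fin (L.Ns p) → ℂ) (d := d)
    (by simp [hp])
    (fun k => L.finrank_quotient_interferenceSpan k (G k) (hMe k) (hII k))
    (fun k => (L.interferenceSpan k (G k)).mkQ ∘ₗ (L.sub k (G k) p).mulVecLin)
    (fun x hx => hal x fun k => by simpa using hx k) p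
  refine ⟨LinearMap.toMatrix' V, fun c hc => ?_, fun j hj c => ?_⟩
  · rw [LinearMap.toMatrix'_mulVec] at hc
    exact hV1 (by rw [hc, map_zero])
  · rw [LinearMap.toMatrix'_mulVec]
    simpa using hV2 c j hj

/-- Alignment with null space feedback: the transmitters in `A` are fed back null spaces by all
other receivers, and those outside `A` are zero-forced. -/
theorem achievesIA_and_dimension_of_nullFeedback (hH : IsGaussianChannel P H) {d : ℕ}
    (A : Finset (Fin K)) (hII : ∀ j, L.link .II j = Aᶜ.erase j)
    (hIII : ∀ j, L.link .III j = A.erase j) (hIV : ∀ j, L.link .IV j = ∅)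
    (hMe : ∀ k, ∑ i ∈ L.link .II k, L.Ns i + d = L.Ms k)
    (hA : ∀ p ∈ A, L.Ns p = K * d) (hB : ∀ p ∉ A, L.Ns p = d) :
    (∀ᵐ ω ∂P, L.realizedDimension (H ω) = ∑ j, ∑ _p ∈ A.erase j, d * ((K : ℤ) * d - d)) ∧
      L.AchievesIA (fun _ => d) P H := by
  have h1 : ∀ᵐ ω ∂P, ∀ k y, L.linkConcat (L.link .II k) k (H ω k) *ᵥ y = 0 → y = 0 :=
    ae_all_iff.2 fun k => L.ae_linkConcat_injective hH _ k (by rw [← hMe k]; omega)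
  have h2 : ∀ᵐ ω ∂P, ∀ p ∈ A, ∀ x,
      (∀ k, L.sub k (H ω k) p *ᵥ x ∈ L.interferenceSpan k (H ω k)) → x = 0 := by
    refine ae_all_iff.2 fun p => Filter.eventually_imp_distrib_left.2 fun hp => ?_
    refine L.ae_eq_zero_of_aligned hH p (fun k => by simp [hII, hp]) (fun _ => d)
      (fun k => (hMe k).le) ?_
    simp [hA p hp]
  -- For `j ∉ A` the `d` columns of the direct link exactly fill the dimensions left free by the
  -- strategy-II links.
  have h3 : ∀ᵐ ω ∂P, ∀ j ∉ A, ∀ y, L.linkConcat Aᶜ j (H ω j) *ᵥ y = 0 → y = 0 := by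
    refine ae_all_iff.2 fun j => Filter.eventually_imp_distrib_left.2 fun hj => ?_
    refine L.ae_linkConcat_injective hH _ j ?_
    rw [← hMe j, hII, ← Finset.sum_erase_add _ _ (Finset.mem_compl.2 hj), hB j hj]
  refine ⟨?_, L.achievesIA_of_ae (fun F i => L.nullPrecoder d F i) ?_⟩
  · filter_upwards [h1, h2] with ω hω1 hω2
    rw [L.realizedDimension_eq hIV]
    refine Finset.sum_congr rfl fun j _ => ?_
    rw [← hIII j, ← Finset.sum_coe_sort (L.link .III j)]
    refine Finset.sum_congr rfl fun p _ => ?_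
    have hpA : p.1 ∈ A := Finset.mem_of_mem_erase (by rw [← hIII j]; exact p.2)
    exact L.grassmannDim_nullFeedback hMe (hA _ hpA) hω1 (hω2 _ hpA) j
  · filter_upwards [h1, h2, h3] with ω hω1 hω2 hω3 j
    have hV := fun i => L.nullPrecoder_spec (d := d) (G := H ω) (i := i) (by
      by_cases hi : i ∈ A
      · obtain ⟨V, hV1, hV2⟩ := L.exists_aligned_precoder hMe (hA i hi) hω1 (hω2 i hi)
        refine ⟨V, hV1, fun j hj => hV2 j ?_⟩
        rw [hIII] at hj
        exact (Finset.ne_of_mem_erase hj).symm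
      · obtain ⟨V, hV⟩ := exists_mulVec_injective (hB i hi).ge
        refine ⟨V, hV, fun j hj => ?_⟩
        rw [hIII] at hj
        exact absurd (Finset.mem_of_mem_erase hj) hi)
    refine ⟨L.interferenceSpan j (H ω j), fun i hij c => ?_, fun c hc => (hV j).1 c ?_⟩
    · by_cases hi : i ∈ A
      · exact (hV i).2 j (by rw [hIII]; exact Finset.mem_erase.2 ⟨hij, hi⟩) c
      · refine L.sub_mulVec_mem_range_linkConcat ?_ j _ _
        rw [hII]
        exact Finset.mem_erase.2 ⟨hij, Finset.mem_compl.2 hi⟩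
    -- If the desired signal of `j ∈ A` also fell into the interference span at `j`, its beam would
    -- be aligned at every receiver, hence zero.
    · by_cases hj : j ∈ A
      · refine hω2 j hj _ fun k => ?_
        by_cases hk : k = j
        · subst hk
          exact hc
        · exact (hV j).2 k (by rw [hIII]; exact Finset.mem_erase.2 ⟨Ne.symm hk, hj⟩) c
      · rw [interferenceSpan, hII] at hc
        exact L.eq_zero_of_mem_range_linkConcat (Finset.mem_compl.2 hj) j _ (hω3 j hj) _ hc

/-- The feedback dimension when the transmitters in `A` are fed back null spaces of dimension
`(K - 1) d` by all other receivers. -/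
theorem feedbackDimension_of_nullFeedback {d : ℕ} (A : Finset (Fin K))
    (hIII : ∀ j, L.link .III j = A.erase j) (hIV : ∀ j, L.link .IV j = ∅)
    (hMe : ∀ k, ∑ i ∈ L.link .II k, L.Ns i + d = L.Ms k) (hA : ∀ p ∈ A, L.Ns p = K * d) :
    L.feedbackDimension = ∑ j, ∑ _p ∈ A.erase j, d * ((K : ℤ) * d - d) := by
  have h : ∀ j, L.Me j = d := by
    intro j
    rw [Me, ← hMe j]
    push_cast
    ring
  rw [feedbackDimension, Finset.sum_eq_zero, zero_add]
  · refine Finset.sum_congr rfl fun j _ => ?_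
    rw [hIII]
    refine Finset.sum_congr rfl fun i hi => ?_
    rw [h, hA i (Finset.mem_of_mem_erase hi)]
    push_cast
    rfl
  · intro j _
    rw [hIV, Finset.sum_empty, h, max_eq_right (by simp), mul_zero]

end FeedbackProfile

/-- Each element of `A` is omitted for exactly one `j`, so it is counted `K - 1` times. -/
theorem sum_sum_erase_const {K : ℕ} (A : Finset (Fin K)) (c : ℤ) :
    ∑ j, ∑ _p ∈ A.erase j, c = ((K : ℤ) - 1) * A.card * c := by
  have h : ∀ j, ∑ _p ∈ A.erase j, c = A.card * c - if j ∈ A then c else 0 := by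
    intro j
    split_ifs with hj
    · have h := Finset.add_sum_erase A (fun _ => c) hj
      rw [Finset.sum_const, Finset.sum_const, nsmul_eq_mul, nsmul_eq_mul] at h
      rw [← h, add_sub_cancel_left, Finset.sum_const, nsmul_eq_mul]
    · rw [Finset.erase_eq_of_notMem hj]
      simp
  rw [Finset.sum_congr rfl fun j _ => h j, Finset.sum_sub_distrib]
  simp
  ring

theorem card_filter_val_le {K κ : ℕ} (h : κ + 2 ≤ K) :
    (Finset.univ.filter fun i : Fin K => (i : ℕ) + 1 ≤ κ + 1).card = κ + 1 := by
  rw [Finset.filter_congr (q := fun i : Fin K => (i : ℕ) < κ + 1) (by simp),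
    Fin.card_filter_val_lt]
  omega

end InterferenceNetwork

/-! ### The two explicit profiles -/

theorem theorem3 (K M N d : ℕ) (hK : 2 ≤ K) (hM2 : 2 ∣ M) (hMK : M ≤ 2 * K + 1)
    (hN : (N : ℚ) = (K : ℚ) * (M : ℚ) / 2) (hdM : d ∣ M)
    {Ω : Type*} [MeasurableSpace Ω] (P : MeasureTheory.Measure Ω)
    [MeasureTheory.IsProbabilityMeasure P]
    (H : Ω → InterferenceNetwork.Channel K (fun _ => M) (fun _ => N))
    (hH : InterferenceNetwork.IsGaussianChannel P H) :
    ((d : ℚ) ≤ (M : ℚ) / (K : ℚ) →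
      ∃ L : InterferenceNetwork.FeedbackProfile K (fun _ => M) (fun _ => N),
        (∀ i, L.Ns i = d ∧ L.Ms i = M) ∧
        (∀ j, L.link .I j = Finset.univ.erase j ∧ L.link .II j = ∅ ∧
          L.link .III j = ∅ ∧ L.link .IV j = ∅) ∧
        L.feedbackDimension = 0 ∧
        (∀ᵐ ω ∂P, L.realizedDimension (H ω) = 0) ∧
        L.AchievesIA (fun _ => d) P H) ∧
    (∀ κ : ℕ, 1 ≤ κ → κ + 2 ≤ K → (d : ℚ) = (M : ℚ) / ((K : ℚ) - (κ : ℚ)) →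
      ∃ L : InterferenceNetwork.FeedbackProfile K (fun _ => M) (fun _ => N),
        (∀ i : Fin K, (i : ℕ) + 1 ≤ κ + 1 → L.Ns i = K * d ∧ L.Ms i = M) ∧
        (∀ i : Fin K, κ + 2 ≤ (i : ℕ) + 1 → L.Ns i = d ∧ (L.Ms i : ℤ) = (M : ℤ) - (d : ℤ)) ∧
        (∀ j : Fin K, L.link .I j = ∅ ∧ L.link .IV j = ∅ ∧
          L.link .II j = (Finset.univ.filter fun i : Fin K => κ + 2 ≤ (i : ℕ) + 1).erase j ∧
          L.link .III j = (Finset.univ.filter fun i : Fin K => (i : ℕ) + 1 ≤ κ + 1).erase j) ∧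
        L.feedbackDimension =
          (((K : ℤ) + 1) * (d : ℤ) ^ 2 - (M : ℤ) * (d : ℤ)) * ((K : ℤ) - 1) ^ 2 ∧
        (∀ᵐ ω ∂P, L.realizedDimension (H ω) =
          (((K : ℤ) + 1) * (d : ℤ) ^ 2 - (M : ℤ) * (d : ℤ)) * ((K : ℤ) - 1) ^ 2) ∧
        L.AchievesIA (fun _ => d) P H) := by
  classical
  have hN2 : 2 * N = K * M := by
    have : (2 : ℚ) * N = K * M := by rw [hN]; ring
    exact_mod_cast this
  have hK0 : (0 : ℚ) < K := by
    have : 0 < K := by omega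
    exact_mod_cast this
  constructor
  · intro hd
    have hKd : K * d ≤ M := by
      rw [le_div_iff₀ hK0] at hd
      have : (K : ℚ) * d ≤ M := by linarith
      exact_mod_cast this
    have hdN : d ≤ N := by nlinarith
    let L : InterferenceNetwork.FeedbackProfile K (fun _ => M) (fun _ => N) :=
      { Ms := fun _ => M
        Ns := fun _ => d
        link := fun s j => match s with
          | .I => Finset.univ.erase j
          | .II => ∅
          | .III => ∅
          | .IV => ∅
        Ms_le := fun _ => le_rfl
        Ns_le := fun _ => hdN
        cover := fun j i => by
          constructor
          · exact fun h => ⟨.I, by simpa using h⟩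
          · rintro ⟨_ | _ | _ | _, h⟩ <;> simp_all
        disjoint := fun j m n h => by cases m <;> cases n <;> simp_all }
    have hIV : ∀ j, L.link .IV j = ∅ := fun _ => rfl
    have hIII : ∀ j, L.link .III j = ∅ := fun _ => rfl
    refine ⟨L, fun _ => ⟨rfl, rfl⟩, fun _ => ⟨rfl, rfl, rfl, rfl⟩, ?_, ?_, ?_⟩
    · simp [InterferenceNetwork.FeedbackProfile.feedbackDimension,
        InterferenceNetwork.FeedbackProfile.Me, L]
    · refine Filter.Eventually.of_forall fun ω => ?_
      rw [L.realizedDimension_eq hIV]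
      refine Finset.sum_eq_zero fun j _ => Finset.sum_eq_zero fun p _ => ?_
      exact absurd p.2 (Finset.notMem_empty _)
    · exact L.achievesIA_of_sum_le hH hIII (fun _ => le_rfl) fun _ => by simpa [L] using hKd
  · intro κ hκ hκK hd
    have hMd : M = (K - κ) * d := by
      have h0 : (0 : ℚ) < (K : ℚ) - κ := by
        have : (κ : ℚ) + 2 ≤ K := by exact_mod_cast hκK
        linarith
      rw [eq_div_iff h0.ne'] at hd
      have : (M : ℚ) = ((K - κ : ℕ) : ℚ) * d := by
        rw [Nat.cast_sub (by omega)]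
        linarith
      exact_mod_cast this
    -- `K - κ ≥ 2` gives `2 * d ≤ M`, and `2 * N = K * M`.
    have hKdN : K * d ≤ N := by
      have : K * (2 * d) ≤ K * M := by
        rw [hMd]
        exact Nat.mul_le_mul_left _ (Nat.mul_le_mul_right _ (by omega))
      linarith
    have hdN : d ≤ N := le_trans (Nat.le_mul_of_pos_left d (by omega)) hKdN
    let A : Finset (Fin K) := Finset.univ.filter fun i : Fin K => (i : ℕ) + 1 ≤ κ + 1
    have hAc : (Finset.univ.filter fun i : Fin K => κ + 2 ≤ (i : ℕ) + 1) = Aᶜ := by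
      ext i
      simp only [A, Finset.mem_filter, Finset.mem_univ, true_and, Finset.mem_compl]
      omega
    have hmem : ∀ i, i ∈ A ↔ (i : ℕ) + 1 ≤ κ + 1 := fun i => by simp [A]
    let L : InterferenceNetwork.FeedbackProfile K (fun _ => M) (fun _ => N) :=
      { Ms := fun j => if j ∈ A then M else M - d
        Ns := fun i => if i ∈ A then K * d else d
        link := fun s j => match s with
          | .I => ∅
          | .II => Aᶜ.erase j
          | .III => A.erase j
          | .IV => ∅
        Ms_le := fun j => by
          split_ifs
          · exact le_rfl
          · exact Nat.sub_le M d
        Ns_le := fun i => by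
          split_ifs
          · exact hKdN
          · exact hdN
        cover := fun j i => by
          constructor
          · intro h
            by_cases hi : i ∈ A
            · exact ⟨.III, Finset.mem_erase.2 ⟨h, hi⟩⟩
            · exact ⟨.II, Finset.mem_erase.2 ⟨h, Finset.mem_compl.2 hi⟩⟩
          · rintro ⟨_ | _ | _ | _, h⟩
            · exact absurd h (Finset.notMem_empty _)
            · exact Finset.ne_of_mem_erase h
            · exact Finset.ne_of_mem_erase h
            · exact absurd h (Finset.notMem_empty _)
        disjoint := fun j m n h => by
          have hd : Disjoint (A.erase j) (Aᶜ.erase j) :=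
            disjoint_compl_right.mono (Finset.erase_subset _ _) (Finset.erase_subset _ _)
          cases m <;> cases n <;> first
            | exact absurd rfl h
            | exact Finset.disjoint_empty_left _
            | exact Finset.disjoint_empty_right _
            | exact hd
            | exact hd.symm }
    have hNsA : ∀ i ∈ A, L.Ns i = K * d := fun i hi => if_pos hi
    have hNsB : ∀ i ∉ A, L.Ns i = d := fun i hi => if_neg hi
    have hII : ∀ j, L.link .II j = Aᶜ.erase j := fun _ => rfl
    have hIII : ∀ j, L.link .III j = A.erase j := fun _ => rfl
    have hIV : ∀ j, L.link .IV j = ∅ := fun _ => rfl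
    have hcard : A.card = κ + 1 := InterferenceNetwork.card_filter_val_le hκK
    -- With `m = K - κ - 2` one has `M = (m + 2) * d` and `m + 1` users outside `A`, free of
    -- truncated subtraction.
    obtain ⟨m, rfl⟩ : ∃ m, K = κ + 2 + m := ⟨K - (κ + 2), by omega⟩
    have hcardc : Aᶜ.card = m + 1 := by
      rw [Finset.card_compl, hcard, Fintype.card_fin]
      omega
    have hMd' : M = (m + 2) * d := by
      rw [hMd]
      congr 1
      omega
    have hdM' : d ≤ M := by rw [hMd']; nlinarith
    -- A receiver in `A` has `m + 1` strategy-II links and `(m + 2) * d` antennas; one outside has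
    -- one link and `d` antennas fewer. Both keep `d` free dimensions.
    have hMe : ∀ k, ∑ i ∈ L.link .II k, L.Ns i + d = L.Ms k := by
      intro k
      have hs : ∑ i ∈ L.link .II k, L.Ns i = (Aᶜ.erase k).card * d := by
        rw [hII, Finset.sum_congr rfl fun i hi =>
          hNsB i (Finset.mem_compl.1 (Finset.mem_of_mem_erase hi)), Finset.sum_const, smul_eq_mul]
      rw [hs]
      by_cases hk : k ∈ A
      · rw [Finset.erase_eq_of_notMem (by simpa using hk), hcardc]
        change _ = ite _ _ _
        rw [if_pos hk, hMd']
        ring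
      · rw [Finset.card_erase_of_mem (Finset.mem_compl.2 hk), hcardc]
        change _ = ite _ _ _
        rw [if_neg hk, hMd']
        apply Nat.eq_sub_of_add_eq
        rw [Nat.add_sub_cancel]
        ring
    -- Since `M = (K - κ) * d`, the factor `(K + 1) * d ^ 2 - M * d` equals `(κ + 1) * d ^ 2`.
    have hD : ∑ j, ∑ _p ∈ A.erase j, (d : ℤ) * (((κ + 2 + m : ℕ) : ℤ) * d - d) =
        ((((κ + 2 + m : ℕ) : ℤ) + 1) * (d : ℤ) ^ 2 - (M : ℤ) * (d : ℤ)) *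
          (((κ + 2 + m : ℕ) : ℤ) - 1) ^ 2 := by
      rw [InterferenceNetwork.sum_sum_erase_const, hcard, hMd']
      push_cast
      ring
    obtain ⟨hreal, hIA⟩ :=
      L.achievesIA_and_dimension_of_nullFeedback hH A hII hIII hIV hMe hNsA hNsB
    refine ⟨L, fun i hi => ⟨hNsA i ((hmem i).2 hi), if_pos ((hmem i).2 hi)⟩, fun i hi => ?_,
      fun j => ⟨rfl, rfl, by rw [hAc, hII], rfl⟩, ?_, ?_, hIA⟩
    · have hi' : i ∉ A := by rw [hmem]; omega
      refine ⟨hNsB i hi', ?_⟩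
      have : L.Ms i = M - d := if_neg hi'
      rw [this, Nat.cast_sub hdM']
    · rw [L.feedbackDimension_of_nullFeedback A hIII hIV hMe hNsA, hD]
    · rw [← hD]
      exact hreal
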